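/- All vector spaces are over $\mathbb C$ and all notions are $\mathbb Z_2$-graded: for a finite-dimensional superspace $V=V_{\bar 0}\oplus V_{\bar 1}$, $\mathfrak{gl}(V)$ is $\mathrm{End}(V)$ with the superbracket $[X,Y]=XY-(-1)^{[X][Y]}YX$ on homogeneous elements, and $\mathfrak{sl}(V)$ is its subalgebra of elements of supertrace $0$; for a Lie superalgebra $\mathfrak g$, $U(\mathfrak g)$ is its enveloping algebra, with the comultiplication $\Delta: U(\mathfrak g)\to U(\mathfrak g)\otimes U(\mathfrak g)$ (graded tensor product) given by $\Delta(X)=X\otimes 1+1\otimes X$ for $X\in\mathfrak g$, and the dual space $U(\mathfrak g)^*$ is an algebra under the product $\langle fg,x\rangle=\langle f\otimes g,\Delta(x)\rangle$, where $\langle f\otimes g,x\otimes y\rangle=(-1)^{[g][x]}f(x)g(y)$; its unit is the counit of $U(\mathfrak g)$. (a) Let $m,n\ge 0$ and $\mathfrak g=\mathfrak{sl}(m|n)=\mathfrak{sl}(\mathbb C^{m|n})$. Let $t$ be the defining representation of $\mathfrak g$ in $\mathbb C^{m|n}$, let $\bar t$ be the dual representation, both extended to $U(\mathfrak g)$, and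 let $t_{ab},\bar t_{ab}\in U(\mathfrak g)^*$ ($1\le a,b\le m+n$) be their matrix elements with respect to the standard basis of $\mathbb C^{m|n}$ and its dual basis. Let $\mathcal A$ be the (unital) subalgebra of $U(\mathfrak g)^*$ generated by all $t_{ab}$ and $\bar t_{ab}$. Then $\mathcal A$ is dense in $U(\mathfrak g)^*$, i.e., for every non-zero $x\in U(\mathfrak g)$ there is some $a\in\mathcal A$ with $\langle a,x\rangle\neq 0$. (b) (Graded version of Harish-Chandra's theorem.) Let $V$ be a finite-dimensional superspace and let $\mathfrak g$ be a graded subalgebra of $\mathfrak{sl}(V)$. Then for every non-zero $x\in U(\mathfrak g)$ there is an integer $r\ge 0$ such that $x$ acts non-trivially on the (graded) tensor power $V^{\otimes r}$. -/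

import Mathlib

open scoped TensorProduct DirectSum

noncomputable section

namespace SuperLie

/-! ### Superspaces and their endomorphisms -/

/-- The sign `(-1)^k` of a parity `k`. -/
def sgn (k : ZMod 2) : ℂ := if k = 0 then 1 else -1

theorem sgn_zero : sgn 0 = 1 := by simp [sgn]

theorem sgn_one : sgn 1 = -1 := by simp [sgn]

theorem eq_zero_or_one (i : ZMod 2) : i = 0 ∨ i = 1 := by
  revert i
  decide

theorem sgn_add (i j : ZMod 2) : sgn (i + j) = sgn i * sgn j := by
  have h : (1 : ZMod 2) + 1 = 0 := by decide
  rcases eq_zero_or_one i with rfl | rfl <;> rcases eq_zero_or_one j with rfl | rfl <;>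
    simp [sgn_zero, sgn_one, h]

theorem sgn_mul_self (i : ZMod 2) : sgn i * sgn i = 1 := by
  rcases eq_zero_or_one i with rfl | rfl <;> simp [sgn_zero, sgn_one]

theorem units_smul_eq_sgn_smul {M : Type*} [AddCommGroup M] [Module ℂ M] (i : ZMod 2) (x : M) :
    ((-1 : ℤˣ) ^ i) • x = sgn i • x := by
  rcases eq_zero_or_one i with rfl | rfl
  · simp [sgn_zero]
  · rw [uzpow_one, sgn_one, Units.smul_def]
    simp

section Superspace

universe u

variable {V : Type u} [AddCommGroup V] [Module ℂ V]

section
variable (𝒱 : ZMod 2 → Submodule ℂ V)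

/-- The endomorphisms of `V` that are homogeneous of degree `k`. -/
def homDeg (k : ZMod 2) : Submodule ℂ (Module.End ℂ V) where
  carrier := {X | ∀ (j : ZMod 2) (v : V), v ∈ 𝒱 j → X v ∈ 𝒱 (j + k)}
  add_mem' hX hY j v hv := (𝒱 (j + k)).add_mem (hX j v hv) (hY j v hv)
  zero_mem' j _ _ := (𝒱 (j + k)).zero_mem
  smul_mem' c _ hX j v hv := (𝒱 (j + k)).smul_mem c (hX j v hv)

variable [DirectSum.Decomposition 𝒱]

/-- The projection of a superspace onto its homogeneous component of degree `k`. -/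
def proj (k : ZMod 2) : Module.End ℂ V :=
  (𝒱 k).subtype ∘ₗ DirectSum.component ℂ (ZMod 2) (fun i => 𝒱 i) k ∘ₗ
    (DirectSum.decomposeLinearEquiv 𝒱).toLinearMap

/-- The map `v ↦ (-1)^{i [v]} v`. -/
def twist (i : ZMod 2) : Module.End ℂ V := ∑ j, sgn (i * j) • proj 𝒱 j

/-- The homogeneous component of degree `k` of an endomorphism. -/
def homComp (k : ZMod 2) : Module.End ℂ V →ₗ[ℂ] Module.End ℂ V :=
  ∑ j, LinearMap.mulLeftRight ℂ (proj 𝒱 (j + k), proj 𝒱 j)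

/-- The supertrace `str X = tr (X restricted to even) - tr (X restricted to odd)`. -/
def supertrace : Module.End ℂ V →ₗ[ℂ] ℂ :=
  LinearMap.trace ℂ V ∘ₗ LinearMap.mulLeft ℂ (proj 𝒱 0 - proj 𝒱 1)

end

variable {𝒱 : ZMod 2 → Submodule ℂ V}

theorem bracket_mem_homDeg {i j : ZMod 2} {X Y : Module.End ℂ V}
    (hX : X ∈ homDeg 𝒱 i) (hY : Y ∈ homDeg 𝒱 j) :
    X * Y - sgn (i * j) • (Y * X) ∈ homDeg 𝒱 (i + j) := by
  refine Submodule.sub_mem _ ?_ (Submodule.smul_mem _ _ ?_)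
  · intro k v hv
    have := hX _ _ (hY k v hv)
    rwa [add_assoc, add_comm j i] at this
  · intro k v hv
    have := hY _ _ (hX k v hv)
    rwa [add_assoc] at this

variable [DirectSum.Decomposition 𝒱]

theorem proj_mem (k : ZMod 2) (v : V) : proj 𝒱 k v ∈ 𝒱 k := by
  simp [proj]

theorem proj_of_mem {k : ZMod 2} {v : V} (hv : v ∈ 𝒱 k) : proj 𝒱 k v = v := by
  exact DirectSum.decompose_of_mem_same 𝒱 hv

theorem proj_of_mem_ne {k l : ZMod 2} {v : V} (hv : v ∈ 𝒱 k) (h : k ≠ l) : proj 𝒱 l v = 0 := by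
  exact DirectSum.decompose_of_mem_ne 𝒱 hv h

theorem sum_proj (v : V) : ∑ k, proj 𝒱 k v = v := by
  refine DirectSum.Decomposition.inductionOn 𝒱 (by simp) ?_ ?_ v
  · intro i m
    rw [Finset.sum_eq_single i]
    · exact proj_of_mem m.2
    · intro b _ hb
      exact proj_of_mem_ne m.2 hb.symm
    · simp
  · intro m m' hm hm'
    simp only [map_add, Finset.sum_add_distrib, hm, hm']

/-- Linear maps that agree on homogeneous vectors are equal. -/
theorem hom_ext {W : Type*} [AddCommGroup W] [Module ℂ W] {f g : V →ₗ[ℂ] W}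
    (h : ∀ k, ∀ v ∈ 𝒱 k, f v = g v) : f = g := by
  ext v
  rw [← sum_proj (𝒱 := 𝒱) v, map_sum, map_sum]
  exact Finset.sum_congr rfl fun k _ => h k _ (proj_mem k v)

theorem twist_of_mem (i : ZMod 2) {k : ZMod 2} {v : V} (hv : v ∈ 𝒱 k) :
    twist 𝒱 i v = sgn (i * k) • v := by
  simp only [twist, LinearMap.sum_apply, LinearMap.smul_apply]
  rw [Finset.sum_eq_single k]
  · rw [proj_of_mem hv]
  · intro b _ hb
    rw [proj_of_mem_ne hv hb.symm, smul_zero]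
  · simp

theorem homComp_apply_of_mem (k : ZMod 2) (X : Module.End ℂ V) {j : ZMod 2} {v : V}
    (hv : v ∈ 𝒱 j) : homComp 𝒱 k X v = proj 𝒱 (j + k) (X v) := by
  simp only [homComp, LinearMap.sum_apply, LinearMap.mulLeftRight_apply, Module.End.mul_apply]
  rw [Finset.sum_eq_single j]
  · rw [proj_of_mem hv]
  · intro b _ hb
    rw [proj_of_mem_ne hv hb.symm, map_zero, map_zero]
  · simp

theorem homComp_mem (k : ZMod 2) (X : Module.End ℂ V) : homComp 𝒱 k X ∈ homDeg 𝒱 k := by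
  intro j v hv
  rw [homComp_apply_of_mem k X hv]
  exact proj_mem _ _

theorem homComp_of_mem {k : ZMod 2} {X : Module.End ℂ V} (hX : X ∈ homDeg 𝒱 k) :
    homComp 𝒱 k X = X :=
  hom_ext (𝒱 := 𝒱) fun j v hv => by
    rw [homComp_apply_of_mem k X hv, proj_of_mem (hX j v hv)]

theorem homComp_of_mem_ne {k l : ZMod 2} {X : Module.End ℂ V} (hX : X ∈ homDeg 𝒱 k)
    (h : k ≠ l) : homComp 𝒱 l X = 0 :=
  hom_ext (𝒱 := 𝒱) fun j v hv => by
    rw [homComp_apply_of_mem l X hv, proj_of_mem_ne (hX j v hv) (by simpa using h)]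
    rfl

theorem sum_homComp (X : Module.End ℂ V) : ∑ k, homComp 𝒱 k X = X :=
  hom_ext (𝒱 := 𝒱) fun j v hv => by
    simp only [LinearMap.sum_apply, homComp_apply_of_mem _ X hv]
    exact (Equiv.sum_comp (Equiv.addLeft j) fun k => proj 𝒱 k (X v)).trans (sum_proj (X v))

theorem twist_zero : twist 𝒱 0 = 1 :=
  hom_ext (𝒱 := 𝒱) fun j v hv => by simp [twist_of_mem 0 hv, sgn_zero]

theorem twist_mul_twist (i j : ZMod 2) : twist 𝒱 i * twist 𝒱 j = twist 𝒱 (i + j) :=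
  hom_ext (𝒱 := 𝒱) fun k v hv => by
    simp [twist_of_mem _ hv, smul_smul, add_mul, sgn_add, mul_comm (sgn (j * k))]

theorem twist_mul {i j : ZMod 2} {X : Module.End ℂ V} (hX : X ∈ homDeg 𝒱 i) :
    twist 𝒱 j * X = sgn (i * j) • (X * twist 𝒱 j) :=
  hom_ext (𝒱 := 𝒱) fun k v hv => by
    simp [twist_of_mem _ hv, twist_of_mem _ (hX k v hv), smul_smul, mul_add, sgn_add, mul_comm]

theorem supertrace_apply (X : Module.End ℂ V) :
    supertrace 𝒱 X = LinearMap.trace ℂ V (twist 𝒱 1 * X) := by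
  have h : proj 𝒱 0 - proj 𝒱 1 = twist 𝒱 1 := by
    have : (Finset.univ : Finset (ZMod 2)) = {0, 1} := by decide
    simp [twist, this, sgn, sub_eq_add_neg]
  simp [supertrace, h]

theorem supertrace_of_odd {X : Module.End ℂ V} (hX : X ∈ homDeg 𝒱 1) : supertrace 𝒱 X = 0 := by
  have h : LinearMap.trace ℂ V (twist 𝒱 1 * X) = -LinearMap.trace ℂ V (twist 𝒱 1 * X) := by
    conv_lhs => rw [twist_mul hX, map_smul, LinearMap.trace_mul_comm]
    simp [sgn_one]
  rw [supertrace_apply]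
  exact self_eq_neg.mp h

theorem supertrace_bracket {i j : ZMod 2} {X Y : Module.End ℂ V}
    (hX : X ∈ homDeg 𝒱 i) (hY : Y ∈ homDeg 𝒱 j) :
    supertrace 𝒱 (X * Y - sgn (i * j) • (Y * X)) = 0 := by
  by_cases hij : i + j = 1
  · have := bracket_mem_homDeg hX hY
    rw [hij] at this
    exact supertrace_of_odd this
  · have h : LinearMap.trace ℂ V (twist 𝒱 1 * (X * Y)) =
        sgn i * LinearMap.trace ℂ V (twist 𝒱 1 * (Y * X)) := by
      rw [← mul_assoc, twist_mul hX, mul_one, smul_mul_assoc, map_smul, mul_assoc,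
        LinearMap.trace_mul_comm, mul_assoc, smul_eq_mul]
    have hs : sgn i = sgn (i * j) := by
      rcases eq_zero_or_one i with rfl | rfl <;> rcases eq_zero_or_one j with rfl | rfl <;>
        simp_all
    rw [supertrace_apply, mul_sub, map_sub, h, hs, mul_smul_comm, map_smul, smul_eq_mul, sub_self]

/-! ### Linear Lie superalgebras -/

variable (𝒱) in
/-- A graded subalgebra of the general linear Lie superalgebra `gl(V)`, whose bracket is
`[X, Y] = X Y - (-1)^{[X][Y]} Y X` on homogeneous elements. -/
structure LinearLieSuperalgebra extends Submodule ℂ (Module.End ℂ V) where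
  homComp_mem' : ∀ X ∈ carrier, ∀ k, homComp 𝒱 k X ∈ carrier
  bracket_mem' : ∀ (i j : ZMod 2) (X Y : Module.End ℂ V), X ∈ carrier → Y ∈ carrier →
    X ∈ homDeg 𝒱 i → Y ∈ homDeg 𝒱 j → X * Y - sgn (i * j) • (Y * X) ∈ carrier

variable (𝒱) in
/-- The special linear Lie superalgebra `sl(V)`: the endomorphisms of supertrace zero. -/
def sl : LinearLieSuperalgebra 𝒱 where
  toSubmodule := LinearMap.ker (supertrace 𝒱)
  homComp_mem' X hX k := by
    have h1 : supertrace 𝒱 (homComp 𝒱 1 X) = 0 := supertrace_of_odd (homComp_mem 1 X)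
    rcases eq_zero_or_one k with rfl | rfl
    · have hu : (Finset.univ : Finset (ZMod 2)) = {0, 1} := by decide
      have h := congrArg (supertrace 𝒱) (sum_homComp (𝒱 := 𝒱) X)
      have hX' : supertrace 𝒱 X = 0 := hX
      rw [hX', hu, Finset.sum_pair (by decide), map_add, h1, add_zero] at h
      exact h
    · exact h1
  bracket_mem' _ _ _ _ _ _ hX hY := supertrace_bracket hX hY

namespace LinearLieSuperalgebra

variable (g : LinearLieSuperalgebra 𝒱)

/-- The homogeneous elements of degree `k` of a linear Lie superalgebra. -/
def deg (k : ZMod 2) : Submodule ℂ g.toSubmodule :=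
  (homDeg 𝒱 k).comap g.toSubmodule.subtype

/-- The homogeneous component of degree `k` of an element of a linear Lie superalgebra. -/
def comp (k : ZMod 2) : g.toSubmodule →ₗ[ℂ] g.toSubmodule :=
  (homComp 𝒱 k).restrict fun X hX => g.homComp_mem' X hX k

theorem comp_mem (k : ZMod 2) (X : g.toSubmodule) : g.comp k X ∈ g.deg k :=
  homComp_mem k X.1

theorem comp_of_mem {k : ZMod 2} {X : g.toSubmodule} (hX : X ∈ g.deg k) : g.comp k X = X :=
  Subtype.ext (homComp_of_mem hX)

theorem comp_of_mem_ne {k l : ZMod 2} {X : g.toSubmodule} (hX : X ∈ g.deg k) (h : k ≠ l) :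
    g.comp l X = 0 :=
  Subtype.ext (homComp_of_mem_ne hX h)

theorem sum_comp (X : g.toSubmodule) : ∑ k, g.comp k X = X := by
  apply Subtype.ext
  rw [AddSubmonoidClass.coe_finsetSum]
  exact sum_homComp X.1

/-- The superbracket of two homogeneous elements. -/
def bracket {i j : ZMod 2} (X : g.deg i) (Y : g.deg j) : g.toSubmodule :=
  ⟨X.1.1 * Y.1.1 - sgn (i * j) • (Y.1.1 * X.1.1),
    g.bracket_mem' i j X.1.1 Y.1.1 X.1.2 Y.1.2 X.2 Y.2⟩

theorem bracket_mem {i j : ZMod 2} (X : g.deg i) (Y : g.deg j) : g.bracket X Y ∈ g.deg (i + j) :=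
  bracket_mem_homDeg X.2 Y.2

/-! ### The enveloping algebra -/

/-- The defining relations `X Y = [X, Y] + (-1)^{[X][Y]} Y X` of the enveloping algebra. -/
inductive Rel : TensorAlgebra ℂ g.toSubmodule → TensorAlgebra ℂ g.toSubmodule → Prop
  | bracket (i j : ZMod 2) (X : g.deg i) (Y : g.deg j) :
      Rel (TensorAlgebra.ι ℂ X.1 * TensorAlgebra.ι ℂ Y.1)
        (TensorAlgebra.ι ℂ (g.bracket X Y) +
          sgn (i * j) • (TensorAlgebra.ι ℂ Y.1 * TensorAlgebra.ι ℂ X.1))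

/-- The enveloping algebra `U(g)` of a linear Lie superalgebra `g`. -/
def Env : Type u := RingQuot g.Rel

instance : Ring g.Env := inferInstanceAs (Ring (RingQuot g.Rel))

instance : Algebra ℂ g.Env := inferInstanceAs (Algebra ℂ (RingQuot g.Rel))

/-- The canonical map `g → U(g)`. -/
def ι : g.toSubmodule →ₗ[ℂ] g.Env :=
  (RingQuot.mkAlgHom ℂ g.Rel).toLinearMap ∘ₗ TensorAlgebra.ι ℂ

theorem ι_mul_ι {i j : ZMod 2} (X : g.deg i) (Y : g.deg j) :
    g.ι X.1 * g.ι Y.1 = g.ι (g.bracket X Y) + sgn (i * j) • (g.ι Y.1 * g.ι X.1) := by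
  have h := RingQuot.mkAlgHom_rel ℂ (Rel.bracket i j X Y)
  rw [map_mul, map_add, map_smul, map_mul] at h
  exact h

/-- The extension of a Lie superalgebra homomorphism from `g` into the superalgebra `B` to an
algebra homomorphism defined on `U(g)`. -/
def lift {B : Type*} [Semiring B] [Algebra ℂ B] (f : g.toSubmodule →ₗ[ℂ] B)
    (hf : ∀ (i j : ZMod 2) (X : g.deg i) (Y : g.deg j),
      f X.1 * f Y.1 = f (g.bracket X Y) + sgn (i * j) • (f Y.1 * f X.1)) : g.Env →ₐ[ℂ] B :=
  RingQuot.liftAlgHom ℂ ⟨TensorAlgebra.lift ℂ f, fun _ _ h => by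
    cases h with
    | bracket i j X Y => simpa using hf i j X Y⟩

@[simp]
theorem lift_ι {B : Type*} [Semiring B] [Algebra ℂ B] (f : g.toSubmodule →ₗ[ℂ] B)
    (hf : ∀ (i j : ZMod 2) (X : g.deg i) (Y : g.deg j),
      f X.1 * f Y.1 = f (g.bracket X Y) + sgn (i * j) • (f Y.1 * f X.1)) (X : g.toSubmodule) :
    g.lift f hf (g.ι X) = f X := by
  refine (RingQuot.liftAlgHom_mkAlgHom_apply ℂ _ _ _).trans ?_
  exact TensorAlgebra.lift_ι_apply f X

theorem algHom_ext {B : Type*} [Semiring B] [Algebra ℂ B] {f f' : g.Env →ₐ[ℂ] B}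
    (h : ∀ X, f (g.ι X) = f' (g.ι X)) : f = f' := by
  refine RingQuot.ringQuot_ext' ℂ f f' ?_
  refine TensorAlgebra.hom_ext (LinearMap.ext fun X => ?_)
  exact h X

/-- The grading of `U(g)`: the component of degree `k` is spanned by the products `X₁ ⋯ Xᵣ` of
homogeneous elements of `g` with `[X₁] + ⋯ + [Xᵣ] = k`. -/
def envDeg (k : ZMod 2) : Submodule ℂ g.Env :=
  Submodule.span ℂ {u | ∃ l : List (Σ i : ZMod 2, g.deg i),
    (l.map Sigma.fst).sum = k ∧ (l.map fun p => g.ι p.2.1).prod = u}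

theorem ι_mem_envDeg {k : ZMod 2} {X : g.toSubmodule} (hX : X ∈ g.deg k) :
    g.ι X ∈ g.envDeg k :=
  Submodule.subset_span ⟨[⟨k, X, hX⟩], by simp, by simp⟩

instance : SetLike.GradedMonoid g.envDeg where
  one_mem := Submodule.subset_span ⟨[], by simp, by simp⟩
  mul_mem i j x y hx hy := by
    have h : g.envDeg i * g.envDeg j ≤ g.envDeg (i + j) := by
      rw [envDeg, envDeg, Submodule.span_mul_span]
      refine Submodule.span_le.mpr ?_
      rintro _ ⟨_, ⟨l, rfl, rfl⟩, _, ⟨l', rfl, rfl⟩, rfl⟩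
      exact Submodule.subset_span ⟨l ++ l', by simp, by simp⟩
    exact h (Submodule.mul_mem_mul hx hy)

theorem of_congr {i j : ZMod 2} (h : i = j) (x : g.envDeg i) (y : g.envDeg j)
    (hxy : (x : g.Env) = y) :
    DirectSum.of (fun k => g.envDeg k) i x = DirectSum.of (fun k => g.envDeg k) j y := by
  subst h
  rw [Subtype.ext hxy]

/-- The map `g → ⨁ U(g)_k` that sends `X` to the family of its components. -/
def gradedι : g.toSubmodule →ₗ[ℂ] ⨁ k, g.envDeg k :=
  ∑ k, DirectSum.lof ℂ (ZMod 2) (fun i => g.envDeg i) k ∘ₗ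
    (g.ι ∘ₗ g.comp k).codRestrict (g.envDeg k) fun X => g.ι_mem_envDeg (g.comp_mem k X)

theorem gradedι_of_mem {k : ZMod 2} (X : g.deg k) :
    g.gradedι X.1 = DirectSum.of (fun i => g.envDeg i) k ⟨g.ι X.1, g.ι_mem_envDeg X.2⟩ := by
  rw [gradedι, LinearMap.sum_apply, Finset.sum_eq_single k]
  · rw [LinearMap.comp_apply, DirectSum.lof_eq_of]
    exact g.of_congr rfl _ _ (congrArg g.ι (g.comp_of_mem X.2))
  · intro b _ hb
    rw [LinearMap.comp_apply]
    have h : (g.ι ∘ₗ g.comp b).codRestrict (g.envDeg b)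
        (fun X => g.ι_mem_envDeg (g.comp_mem b X)) X.1 = 0 := by
      apply Subtype.ext
      change g.ι (g.comp b X.1) = 0
      rw [g.comp_of_mem_ne X.2 hb.symm, map_zero]
    rw [h, map_zero]
  · simp

/-- The map `U(g) → ⨁ U(g)_k` that decomposes an element into its components. -/
def gradedLift : g.Env →ₐ[ℂ] ⨁ k, g.envDeg k :=
  g.lift g.gradedι fun i j X Y => by
    have h := g.gradedι_of_mem ⟨g.bracket X Y, g.bracket_mem X Y⟩
    dsimp only at h
    rw [h, gradedι_of_mem, gradedι_of_mem, DirectSum.of_mul_of, DirectSum.of_mul_of,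
      ← DirectSum.lof_eq_of ℂ, ← DirectSum.lof_eq_of ℂ, ← DirectSum.lof_eq_of ℂ, ← map_smul,
      DirectSum.lof_eq_of, DirectSum.lof_eq_of, DirectSum.lof_eq_of,
      g.of_congr (add_comm j i) (sgn (i * j) • _)
        ⟨sgn (i * j) • (g.ι Y.1 * g.ι X.1), by
          rw [add_comm]
          exact Submodule.smul_mem _ _ (SetLike.mul_mem_graded (g.ι_mem_envDeg Y.2)
            (g.ι_mem_envDeg X.2))⟩ rfl, ← map_add]
    exact g.of_congr rfl _ _ (g.ι_mul_ι X Y)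

/-- `U(g)` is a superalgebra. -/
instance : GradedAlgebra g.envDeg :=
  GradedAlgebra.ofAlgHom g.envDeg g.gradedLift
    (by
      refine g.algHom_ext fun X => ?_
      conv_lhs => rw [← g.sum_comp X]
      conv_rhs => rw [← g.sum_comp X]
      simp only [map_sum]
      refine Finset.sum_congr rfl fun k _ => ?_
      have h := g.gradedι_of_mem ⟨g.comp k X, g.comp_mem k X⟩
      dsimp only at h
      rw [AlgHom.comp_apply, gradedLift, lift_ι, h, DirectSum.coeAlgHom_of]
      rfl)
    (by
      rintro k ⟨x, hx⟩
      dsimp only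
      induction hx using Submodule.span_induction with
      | mem x hx =>
        obtain ⟨l, rfl, rfl⟩ := hx
        induction l with
        | nil =>
          simp only [List.map_nil, List.prod_nil, map_one]
          exact g.of_congr rfl _ _ rfl
        | cons p l ih =>
          simp only [List.map_cons, List.prod_cons, map_mul]
          rw [ih, gradedLift, lift_ι, gradedι_of_mem, DirectSum.of_mul_of]
          exact g.of_congr (by simp) _ _ rfl
      | zero =>
        rw [map_zero]
        exact (map_zero _).symm
      | add x y hx hy hx' hy' =>
        rw [map_add, hx', hy', ← map_add]
        rfl
      | smul c x hx hx' =>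
        rw [map_smul, hx', ← DirectSum.lof_eq_of ℂ, ← DirectSum.lof_eq_of ℂ, ← map_smul]
        rfl)

/-! ### The Hopf structure of `U(g)` and the product on `U(g)*` -/

/-- The counit of `U(g)`. -/
def counit : g.Env →ₐ[ℂ] ℂ := g.lift 0 fun _ _ _ _ => by simp

/-- The comultiplication `Δ : U(g) → U(g) ⊗ U(g)`, with values in the graded tensor product: the
homomorphism of algebras such that `Δ(X) = X ⊗ 1 + 1 ⊗ X` for `X ∈ g`. -/
def comul : g.Env →ₐ[ℂ] g.envDeg ᵍ⊗[ℂ] g.envDeg :=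
  g.lift
    ((GradedTensorProduct.includeLeft g.envDeg g.envDeg).toLinearMap ∘ₗ g.ι +
      (GradedTensorProduct.includeRight g.envDeg g.envDeg).toLinearMap ∘ₗ g.ι)
    fun i j X Y => by
      have key : ∀ {i j : ZMod 2} (X : g.deg i) (Y : g.deg j),
          (1 ᵍ⊗ₜ[ℂ] g.ι X.1 : g.envDeg ᵍ⊗[ℂ] g.envDeg) * (g.ι Y.1) ᵍ⊗ₜ[ℂ] 1 =
            sgn (i * j) • (g.ι Y.1) ᵍ⊗ₜ[ℂ] (g.ι X.1) := fun {i j} X Y => by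
        have h := GradedTensorProduct.tmul_coe_mul_coe_tmul (R := ℂ) g.envDeg g.envDeg 1
          ⟨g.ι X.1, g.ι_mem_envDeg X.2⟩ ⟨g.ι Y.1, g.ι_mem_envDeg Y.2⟩ 1
        rw [one_mul, mul_one, units_smul_eq_sgn_smul] at h
        exact h
      have key' : ∀ {i j : ZMod 2} (X : g.deg i) (Y : g.deg j),
          ((g.ι Y.1) ᵍ⊗ₜ[ℂ] 1 : g.envDeg ᵍ⊗[ℂ] g.envDeg) * 1 ᵍ⊗ₜ[ℂ] g.ι X.1 =
            (g.ι Y.1) ᵍ⊗ₜ[ℂ] (g.ι X.1) := fun X Y => by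
        rw [GradedTensorProduct.tmul_one_mul_one_tmul]
      have hL := congrArg (GradedTensorProduct.includeLeft g.envDeg g.envDeg) (g.ι_mul_ι X Y)
      have hR := congrArg (GradedTensorProduct.includeRight g.envDeg g.envDeg) (g.ι_mul_ι X Y)
      rw [map_mul, map_add, map_smul, map_mul] at hL hR
      simp only [LinearMap.add_apply, LinearMap.comp_apply, AlgHom.toLinearMap_apply, mul_add,
        add_mul, hL, hR]
      simp only [GradedTensorProduct.includeLeft_apply, GradedTensorProduct.includeRight_apply,
        key, key', smul_add, smul_smul, mul_comm j i, sgn_mul_self, one_smul]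
      abel

/-- The linear form `φ ⊗ ψ` on `U(g) ⊗ U(g)`, in the graded sense:
`(φ ⊗ ψ)(x ⊗ y) = (-1)^{[ψ][x]} φ(x) ψ(y)`. The component of degree `j` of `ψ` is `ψ ∘ proj j`. -/
def pairTensor (φ ψ : Module.Dual ℂ g.Env) : g.Env ⊗[ℂ] g.Env →ₗ[ℂ] ℂ :=
  ∑ i, ∑ j, sgn (j * i) • (LinearMap.mul' ℂ ℂ ∘ₗ
    TensorProduct.map (φ ∘ₗ proj g.envDeg i) (ψ ∘ₗ proj g.envDeg j))

/-- The product on `U(g)*` that is dual to the comultiplication of `U(g)`. -/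
def dualMul (φ ψ : Module.Dual ℂ g.Env) : Module.Dual ℂ g.Env :=
  g.pairTensor φ ψ ∘ₗ (GradedTensorProduct.of ℂ g.envDeg g.envDeg).symm.toLinearMap ∘ₗ
    g.comul.toLinearMap

/-- The (unital) subalgebra of `U(g)*` generated by a set `S` of linear forms. The unit element
of `U(g)*` is the counit of `U(g)`. -/
def generatedAlgebra (S : Set (Module.Dual ℂ g.Env)) : Submodule ℂ (Module.Dual ℂ g.Env) :=
  sInf {A | g.counit.toLinearMap ∈ A ∧ S ⊆ A ∧ ∀ φ ∈ A, ∀ ψ ∈ A, g.dualMul φ ψ ∈ A}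

/-- A subspace `A` of `U(g)*` is dense if for every non-zero `x ∈ U(g)` there is some `a ∈ A`
such that `⟨a, x⟩ ≠ 0`. -/
def IsDenseInDual (A : Submodule ℂ (Module.Dual ℂ g.Env)) : Prop :=
  ∀ x : g.Env, x ≠ 0 → ∃ a ∈ A, a x ≠ 0

/-! ### The defining representation, its dual and its tensor powers -/

/-- The defining representation of `g` on `V`, extended to `U(g)`. -/
def stdRep : g.Env →ₐ[ℂ] Module.End ℂ V :=
  g.lift g.toSubmodule.subtype fun i j X Y => by
    change X.1.1 * Y.1.1 = (X.1.1 * Y.1.1 - sgn (i * j) • (Y.1.1 * X.1.1)) + _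
    exact (sub_add_cancel _ _).symm

variable (𝒱) in
/-- The action of `X ∈ gl(V)` on the dual space: `(X ψ)(v) = -(-1)^{[X][ψ]} ψ(X v)`. -/
def dualAct : Module.End ℂ V →ₗ[ℂ] Module.End ℂ (Module.Dual ℂ V) :=
  -∑ i, Module.Dual.transpose ∘ₗ LinearMap.mulLeft ℂ (twist 𝒱 i) ∘ₗ homComp 𝒱 i

theorem dualAct_of_mem {i : ZMod 2} {X : Module.End ℂ V} (hX : X ∈ homDeg 𝒱 i)
    (ψ : Module.Dual ℂ V) : dualAct 𝒱 X ψ = -(ψ ∘ₗ (twist 𝒱 i * X)) := by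
  simp only [dualAct, LinearMap.neg_apply, LinearMap.sum_apply, LinearMap.comp_apply]
  rw [Finset.sum_eq_single i]
  · rw [homComp_of_mem hX]
    rfl
  · intro b _ hb
    rw [homComp_of_mem_ne hX hb.symm]
    simp
  · simp

/-- The dual of the defining representation, extended to `U(g)`. -/
def dualRep : g.Env →ₐ[ℂ] Module.End ℂ (Module.Dual ℂ V) :=
  g.lift (dualAct 𝒱 ∘ₗ g.toSubmodule.subtype) fun i j X Y => by
    refine LinearMap.ext fun ψ => ?_
    have hX : X.1.1 ∈ homDeg 𝒱 i := X.2
    have hY : Y.1.1 ∈ homDeg 𝒱 j := Y.2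
    have hb : (g.bracket X Y).1 ∈ homDeg 𝒱 (i + j) := g.bracket_mem X Y
    have key : ∀ {i j : ZMod 2} {X Y : Module.End ℂ V} (_ : X ∈ homDeg 𝒱 i)
        (_ : Y ∈ homDeg 𝒱 j), dualAct 𝒱 X (dualAct 𝒱 Y ψ) =
          sgn (i * j) • (ψ ∘ₗ (twist 𝒱 (i + j) * (Y * X))) := fun {i j X Y} hX hY => by
      rw [dualAct_of_mem hX, dualAct_of_mem hY, LinearMap.neg_comp, neg_neg, LinearMap.comp_assoc]
      change ψ ∘ₗ (twist 𝒱 j * Y * (twist 𝒱 i * X)) = _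
      have h : Y * twist 𝒱 i = sgn (i * j) • (twist 𝒱 i * Y) := by
        rw [twist_mul hY, smul_smul, mul_comm j i, sgn_mul_self, one_smul]
      rw [mul_assoc, ← mul_assoc Y, h, smul_mul_assoc, mul_smul_comm, ← mul_assoc, ← mul_assoc,
        twist_mul_twist, mul_assoc, add_comm j i, LinearMap.comp_smul]
    change dualAct 𝒱 X.1.1 (dualAct 𝒱 Y.1.1 ψ) = dualAct 𝒱 (g.bracket X Y).1 ψ +
      sgn (i * j) • dualAct 𝒱 Y.1.1 (dualAct 𝒱 X.1.1 ψ)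
    rw [key hX hY, key hY hX, dualAct_of_mem hb, smul_smul, mul_comm j i, sgn_mul_self, one_smul]
    change _ = -(ψ ∘ₗ (twist 𝒱 (i + j) * (X.1.1 * Y.1.1 - sgn (i * j) • (Y.1.1 * X.1.1)))) + _
    rw [mul_sub, mul_smul_comm, LinearMap.comp_sub, LinearMap.comp_smul, add_comm j i]
    abel

variable (𝒱) in
/-- The summand of the action of `X` on `V ⊗ ⋯ ⊗ V` in which `X` acts on the factor number `k`:
`v₁ ⊗ ⋯ ⊗ vᵣ ↦ (-1)^{[X]([v₁] + ⋯ + [vₖ₋₁])} v₁ ⊗ ⋯ ⊗ X vₖ ⊗ ⋯ ⊗ vᵣ`, for `X` of degree `i`. -/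
def tensorSlot (r : ℕ) (i : ZMod 2) (k : Fin r) (X : Module.End ℂ V) :
    Module.End ℂ (⨂[ℂ] (_ : Fin r), V) :=
  PiTensorProduct.map fun l => if l < k then twist 𝒱 i else if l = k then X else LinearMap.id

theorem tensorSlot_eq (r : ℕ) (i : ZMod 2) (k : Fin r) (X : Module.End ℂ V) :
    tensorSlot 𝒱 r i k X = (PiTensorProduct.mapMultilinear ℂ (fun _ : Fin r => V)
      (fun _ => V)).toLinearMap (fun l => if l < k then twist 𝒱 i else LinearMap.id) k X := by
  rw [tensorSlot, MultilinearMap.toLinearMap_apply, PiTensorProduct.mapMultilinear_apply]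
  congr 1
  funext l
  by_cases h : l = k
  · subst h
    simp
  · simp [h]

variable (𝒱) in
/-- The action of `X ∈ gl(V)` on the tensor power `V ⊗ ⋯ ⊗ V` with `r` factors. -/
def tensorAct (r : ℕ) : Module.End ℂ V →ₗ[ℂ] Module.End ℂ (⨂[ℂ] (_ : Fin r), V) where
  toFun X := ∑ k, ∑ i, tensorSlot 𝒱 r i k (homComp 𝒱 i X)
  map_add' X Y := by
    simp only [tensorSlot_eq, map_add, Finset.sum_add_distrib]
  map_smul' c X := by
    simp only [tensorSlot_eq, map_smul, Finset.smul_sum, RingHom.id_apply]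

theorem tensorAct_of_mem (r : ℕ) {i : ZMod 2} {X : Module.End ℂ V} (hX : X ∈ homDeg 𝒱 i) :
    tensorAct 𝒱 r X = ∑ k, tensorSlot 𝒱 r i k X := by
  change ∑ k, ∑ j, tensorSlot 𝒱 r j k (homComp 𝒱 j X) = _
  refine Finset.sum_congr rfl fun k _ => ?_
  rw [Finset.sum_eq_single i]
  · rw [homComp_of_mem hX]
  · intro b _ hb
    rw [homComp_of_mem_ne hX hb.symm, tensorSlot_eq, map_zero]
  · simp

theorem tensorSlot_same (r : ℕ) {i j : ZMod 2} (k : Fin r) (X Y : Module.End ℂ V) :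
    tensorSlot 𝒱 r i k X * tensorSlot 𝒱 r j k Y = tensorSlot 𝒱 r (i + j) k (X * Y) := by
  rw [tensorSlot, tensorSlot, tensorSlot, ← PiTensorProduct.map_mul]
  congr 1
  funext l
  split_ifs
  · exact twist_mul_twist i j
  · rfl
  · rfl

theorem tensorSlot_lt (r : ℕ) {i j : ZMod 2} {k l : Fin r} (h : k < l)
    {X : Module.End ℂ V} (hX : X ∈ homDeg 𝒱 i) (Y : Module.End ℂ V) :
    tensorSlot 𝒱 r j l Y * tensorSlot 𝒱 r i k X =
      sgn (i * j) • (tensorSlot 𝒱 r i k X * tensorSlot 𝒱 r j l Y) := by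
  have hk : ∀ m : Fin r, ((if m < l then twist 𝒱 j else if m = l then Y else LinearMap.id) *
      (if m < k then twist 𝒱 i else if m = k then X else LinearMap.id) : Module.End ℂ V) =
      Function.update (fun m => (if m < k then twist 𝒱 i else if m = k then X else LinearMap.id) *
        (if m < l then twist 𝒱 j else if m = l then Y else LinearMap.id)) k
        (sgn (i * j) • (X * twist 𝒱 j)) m := by
    intro m
    rcases lt_trichotomy m k with hm | rfl | hm
    · rw [Function.update_of_ne hm.ne]
      simp [hm, hm.trans h, twist_mul_twist, add_comm]
    · simp [h, twist_mul hX]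
    · rw [Function.update_of_ne hm.ne']
      simp only [hm.not_gt, hm.ne', if_false]
      exact (mul_one _).trans (one_mul _).symm
  rw [tensorSlot, tensorSlot, ← PiTensorProduct.map_mul, ← PiTensorProduct.map_mul, funext hk,
    PiTensorProduct.map_update_smul]
  congr 2
  refine Function.update_eq_self_iff.mpr ?_
  simp [h]

theorem tensorSlot_ne (r : ℕ) {i j : ZMod 2} {k l : Fin r} (h : k ≠ l) {X Y : Module.End ℂ V}
    (hX : X ∈ homDeg 𝒱 i) (hY : Y ∈ homDeg 𝒱 j) :
    tensorSlot 𝒱 r i k X * tensorSlot 𝒱 r j l Y =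
      sgn (i * j) • (tensorSlot 𝒱 r j l Y * tensorSlot 𝒱 r i k X) := by
  rcases lt_or_gt_of_ne h with h | h
  · rw [tensorSlot_lt r h hX Y, smul_smul, sgn_mul_self, one_smul]
  · rw [tensorSlot_lt r h hY X, mul_comm j i]

/-- The action of `U(g)` on the tensor power `V ⊗ ⋯ ⊗ V` with `r` factors, in the graded sense. -/
def tensorRep (r : ℕ) : g.Env →ₐ[ℂ] Module.End ℂ (⨂[ℂ] (_ : Fin r), V) :=
  g.lift (tensorAct 𝒱 r ∘ₗ g.toSubmodule.subtype) fun i j X Y => by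
    have hX : X.1.1 ∈ homDeg 𝒱 i := X.2
    have hY : Y.1.1 ∈ homDeg 𝒱 j := Y.2
    have hb : X.1.1 * Y.1.1 - sgn (i * j) • (Y.1.1 * X.1.1) ∈ homDeg 𝒱 (i + j) :=
      g.bracket_mem X Y
    change tensorAct 𝒱 r X.1.1 * tensorAct 𝒱 r Y.1.1 =
      tensorAct 𝒱 r (X.1.1 * Y.1.1 - sgn (i * j) • (Y.1.1 * X.1.1)) +
      sgn (i * j) • (tensorAct 𝒱 r Y.1.1 * tensorAct 𝒱 r X.1.1)
    rw [tensorAct_of_mem r hX, tensorAct_of_mem r hY, tensorAct_of_mem r hb, Finset.sum_mul_sum,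
      Finset.sum_mul_sum, Finset.sum_comm (f := fun k l => tensorSlot 𝒱 r j k Y.1.1 * _),
      Finset.smul_sum, ← Finset.sum_add_distrib]
    refine Finset.sum_congr rfl fun k _ => ?_
    rw [Finset.smul_sum, ← sub_eq_iff_eq_add, ← Finset.sum_sub_distrib, Finset.sum_eq_single k]
    · rw [tensorSlot_same, tensorSlot_same, add_comm j i, tensorSlot_eq, tensorSlot_eq,
        tensorSlot_eq, ← map_smul, ← map_sub]
    · intro l _ hl
      rw [tensorSlot_ne r hl.symm hX hY, sub_self]
    · simp

end LinearLieSuperalgebra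

end Superspace

/-! ### The special linear Lie superalgebra `sl(m|n)` and its matrix elements -/

section SpecialLinear

variable (m n : ℕ)

/-- The parity of an index: the first `m` indices are even, the last `n` indices are odd. -/
def parity : Fin m ⊕ Fin n → ZMod 2 := Sum.elim (fun _ => 0) (fun _ => 1)

/-- The grading of the superspace `ℂ^{m|n}`: the component of degree `k` consists of the vectors
that are supported on the indices of parity `k`. -/
def stdGrading (k : ZMod 2) : Submodule ℂ (Fin m ⊕ Fin n → ℂ) where
  carrier := {v | ∀ a, parity m n a ≠ k → v a = 0}
  add_mem' hv hw a ha := by simp [hv a ha, hw a ha]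
  zero_mem' _ _ := rfl
  smul_mem' c v hv a ha := by simp [hv a ha]

/-- The projection of `ℂ^{m|n}` onto its component of degree `k`. -/
def stdProj (k : ZMod 2) : (Fin m ⊕ Fin n → ℂ) →ₗ[ℂ] stdGrading m n k where
  toFun v := ⟨fun a => if parity m n a = k then v a else 0, fun _ ha => if_neg ha⟩
  map_add' v w := Subtype.ext <| funext fun a => by
    by_cases h : parity m n a = k <;> simp [h]
  map_smul' c v := Subtype.ext <| funext fun a => by
    by_cases h : parity m n a = k <;> simp [h]

theorem stdProj_apply (k : ZMod 2) (v : Fin m ⊕ Fin n → ℂ) (a : Fin m ⊕ Fin n) :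
    (stdProj m n k v).1 a = if parity m n a = k then v a else 0 := rfl

instance : DirectSum.Decomposition (stdGrading m n) :=
  DirectSum.Decomposition.ofLinearMap (stdGrading m n)
    (∑ k, DirectSum.lof ℂ (ZMod 2) (fun i => stdGrading m n i) k ∘ₗ stdProj m n k)
    (by
      refine LinearMap.ext fun v => funext fun a => ?_
      simp only [LinearMap.comp_apply, LinearMap.sum_apply, map_sum, DirectSum.coeLinearMap_lof,
        Finset.sum_apply, stdProj_apply, LinearMap.id_apply]
      simp)
    (by
      refine DirectSum.linearMap_ext ℂ fun k => LinearMap.ext fun v => ?_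
      simp only [LinearMap.comp_apply, LinearMap.sum_apply, DirectSum.coeLinearMap_lof,
        LinearMap.id_apply]
      rw [Finset.sum_eq_single k]
      · congr 1
        refine Subtype.ext (funext fun a => ?_)
        rw [stdProj_apply]
        by_cases h : parity m n a = k
        · rw [if_pos h]
        · rw [if_neg h, v.2 a h]
      · intro b _ hb
        have h0 : stdProj m n b v.1 = 0 := by
          refine Subtype.ext (funext fun a => ?_)
          rw [stdProj_apply]
          by_cases h : parity m n a = b
          · rw [if_pos h, v.2 a (by rw [h]; exact hb)]
            rfl
          · rw [if_neg h]
            rfl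
        rw [h0, map_zero]
      · simp)

/-- The Lie superalgebra `sl(m|n)`, acting on `ℂ^{m|n}`. -/
abbrev slmn : LinearLieSuperalgebra (stdGrading m n) := sl (stdGrading m n)

/-- The matrix element `t_{ab} ∈ U(sl(m|n))*` of the defining representation `t`, with respect to
the standard basis `e_a` of `ℂ^{m|n}`. -/
def tElem (a b : Fin m ⊕ Fin n) : Module.Dual ℂ (slmn m n).Env :=
  LinearMap.proj a ∘ₗ LinearMap.applyₗ (Pi.single b (1 : ℂ)) ∘ₗ (slmn m n).stdRep.toLinearMap

/-- The matrix element `t̄_{ab} ∈ U(sl(m|n))*` of the representation dual to `t`, with respect to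
the basis dual to the standard basis of `ℂ^{m|n}`. -/
def tBarElem (a b : Fin m ⊕ Fin n) : Module.Dual ℂ (slmn m n).Env :=
  LinearMap.applyₗ (Pi.single a (1 : ℂ)) ∘ₗ
    LinearMap.applyₗ (LinearMap.proj b : Module.Dual ℂ (Fin m ⊕ Fin n → ℂ)) ∘ₗ
    (slmn m n).dualRep.toLinearMap

/-- The subalgebra `A` of `U(sl(m|n))*` generated by the matrix elements `t_{ab}` and `t̄_{ab}`. -/
def functionAlgebra : Submodule ℂ (Module.Dual ℂ (slmn m n).Env) :=
  (slmn m n).generatedAlgebra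
    (Set.range (fun p : (Fin m ⊕ Fin n) × (Fin m ⊕ Fin n) => tElem m n p.1 p.2) ∪
      Set.range fun p : (Fin m ⊕ Fin n) × (Fin m ⊕ Fin n) => tBarElem m n p.1 p.2)

end SpecialLinear

end SuperLie

end

/-!
Write `Δ(x) = ∑ x₁ ⊗ x₂` and let `contract f x = ∑ (-1)^{[f][x₁]} f(x₂) x₁` for a linear form `f`
on `U(g)`, so that `⟨a f, x⟩ = ⟨a, contract f x⟩`. Both parts follow from one statement
(`eq_bot_of_contract_stdRep_mem`): a subspace `K` of `U(g)` that is annihilated by the counit and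
stable under contraction with the matrix elements of the defining representation is zero.

For its proof, `U(g)` is filtered by the length of words. Contraction with a form `f` such that
`f(1) = 0` lowers the filtration. If `Xᵢ` is a homogeneous basis of `g` and `fᵢ` are linear forms
on `U(g)` with `fᵢ(Xⱼ) = δᵢⱼ` and `fᵢ(1) = 0`, the operator `∑ᵢ Xᵢ · contract fᵢ` is, on words of
length `N`, multiplication by `N` up to shorter words (`euler_word_sub_mem_filt`); this is Euler's
identity for the associated graded algebra. It follows by induction on `N` that `K` contains no
non-zero element of filtration degree at most `N`: contractions of such an element with `fᵢ` lie
in `K` and have lower degree, so they vanish, whence `N` times the element has lower degree as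
well. This uses neither the linear independence in the Poincaré–Birkhoff–Witt theorem nor ordered
monomials. The forms `fᵢ` exist because `g` acts faithfully on `V`: they are matrix elements of
`V` minus multiples of the counit.

For (a), `K` is the annihilator of the algebra of matrix elements. For (b), `K` consists of the
elements that act trivially on all tensor powers; it is stable because the action of
`contract f x` on `V^{⊗ r}`, with `f` a homogeneous matrix element, is up to sign a block of the
action of `x` on `V^{⊗ (r + 1)}` (`tensorRep_contract`).
-/

noncomputable section

namespace SuperLie

namespace LinearLieSuperalgebra

universe u

variable {V : Type u} [AddCommGroup V] [Module ℂ V] {𝒱 : ZMod 2 → Submodule ℂ V}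
  [DirectSum.Decomposition 𝒱] (g : LinearLieSuperalgebra 𝒱)

/-! ### Words in homogeneous elements -/

/-- The product in `U(g)` of a word whose letters are homogeneous elements of `g`. -/
def word (l : List (Σ i : ZMod 2, g.deg i)) : g.Env := (l.map fun p => g.ι p.2.1).prod

@[simp]
theorem word_nil : g.word [] = 1 := rfl

@[simp]
theorem word_cons (p : Σ i : ZMod 2, g.deg i) (l : List (Σ i : ZMod 2, g.deg i)) :
    g.word (p :: l) = g.ι p.2.1 * g.word l := by
  simp [word]

theorem span_range_word : Submodule.span ℂ (Set.range g.word) = ⊤ := by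
  refine (eq_top_iff.mpr fun x _ => ?_)
  rw [← sum_proj (𝒱 := g.envDeg) x]
  refine Submodule.sum_mem _ fun k _ => ?_
  refine Submodule.span_mono ?_ (proj_mem (𝒱 := g.envDeg) k x)
  rintro _ ⟨l, -, rfl⟩
  exact ⟨l, rfl⟩

/-- Two linear maps on `U(g)` are equal if they agree on words. -/
theorem linearMap_ext_word {M : Type*} [AddCommMonoid M] [Module ℂ M] {φ ψ : g.Env →ₗ[ℂ] M}
    (h : ∀ l, φ (g.word l) = ψ (g.word l)) : φ = ψ :=
  LinearMap.ext_on_range g.span_range_word h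

theorem one_mem_envDeg : (1 : g.Env) ∈ g.envDeg 0 := SetLike.GradedOne.one_mem

@[simp]
theorem twist_one (p : ZMod 2) : twist g.envDeg p 1 = 1 := by
  rw [twist_of_mem p g.one_mem_envDeg, mul_zero, sgn_zero, one_smul]

theorem ι_mul_mem_envDeg {i k : ZMod 2} (X : g.deg i) {a : g.Env} (ha : a ∈ g.envDeg k) :
    g.ι X.1 * a ∈ g.envDeg (i + k) :=
  SetLike.mul_mem_graded (g.ι_mem_envDeg X.2) ha

theorem twist_ι_mul {i : ZMod 2} (p : ZMod 2) (X : g.deg i) (a : g.Env) :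
    twist g.envDeg p (g.ι X.1 * a) = sgn (p * i) • (g.ι X.1 * twist g.envDeg p a) := by
  refine LinearMap.congr_fun (f := twist g.envDeg p ∘ₗ LinearMap.mulLeft ℂ (g.ι X.1))
    (g := sgn (p * i) • (LinearMap.mulLeft ℂ (g.ι X.1) ∘ₗ twist g.envDeg p))
    (hom_ext (𝒱 := g.envDeg) fun k a ha => ?_) a
  simp [twist_of_mem p ha, twist_of_mem p (g.ι_mul_mem_envDeg X ha), mul_add, sgn_add, smul_smul]

theorem proj_twist (p k : ZMod 2) (x : g.Env) :
    proj g.envDeg k (twist g.envDeg p x) = sgn (p * k) • proj g.envDeg k x := by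
  refine LinearMap.congr_fun (f := proj g.envDeg k ∘ₗ twist g.envDeg p)
    (g := sgn (p * k) • proj g.envDeg k) (hom_ext (𝒱 := g.envDeg) fun j a ha => ?_) x
  rw [LinearMap.comp_apply, twist_of_mem p ha, map_smul, LinearMap.smul_apply]
  by_cases h : j = k
  · rw [h]
  · rw [proj_of_mem_ne ha h, smul_zero, smul_zero]

@[simp]
theorem counit_ι (X : g.toSubmodule) : g.counit (g.ι X) = 0 := by
  simp [counit]

theorem counit_twist (p : ZMod 2) (x : g.Env) : g.counit (twist g.envDeg p x) = g.counit x := by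
  refine LinearMap.congr_fun (f := g.counit.toLinearMap ∘ₗ twist g.envDeg p)
    (g := g.counit.toLinearMap) (g.linearMap_ext_word fun l => ?_) x
  cases l with
  | nil => simp
  | cons q l => simp [twist_ι_mul]

/-! ### Contraction of the second factor of the comultiplication -/

/-- The map `a ⊗ b ↦ (-1)^{[f][a]} f(b) a` on `U(g) ⊗ U(g)`. -/
def contractTensor (f : Module.Dual ℂ g.Env) : g.Env ⊗[ℂ] g.Env →ₗ[ℂ] g.Env :=
  ∑ j, (TensorProduct.rid ℂ g.Env).toLinearMap ∘ₗ
    TensorProduct.map (twist g.envDeg j) (f ∘ₗ proj g.envDeg j)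

theorem contractTensor_tmul (f : Module.Dual ℂ g.Env) {j : ZMod 2} (a : g.Env) {b : g.Env}
    (hb : b ∈ g.envDeg j) : g.contractTensor f (a ⊗ₜ b) = f b • twist g.envDeg j a := by
  simp only [contractTensor, LinearMap.sum_apply, LinearMap.comp_apply, TensorProduct.map_tmul,
    LinearEquiv.coe_coe, TensorProduct.rid_tmul]
  rw [Finset.sum_eq_single j]
  · rw [proj_of_mem hb]
  · intro k _ hk
    rw [proj_of_mem_ne hb hk.symm, map_zero, zero_smul]
  · simp

/-- The contraction of `Δ(x) = ∑ x₁ ⊗ x₂` with a linear form `f` on the second factor: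
`x ↦ ∑ (-1)^{[f][x₁]} f(x₂) x₁`. It is the transpose of the multiplication by `f` from the right
in `U(g)*`. -/
def contract : Module.Dual ℂ g.Env →ₗ[ℂ] Module.End ℂ g.Env where
  toFun f := g.contractTensor f ∘ₗ
    (GradedTensorProduct.of ℂ g.envDeg g.envDeg).symm.toLinearMap ∘ₗ g.comul.toLinearMap
  map_add' f f' := by
    simp [contractTensor, LinearMap.add_comp, TensorProduct.map_add_right, LinearMap.comp_add,
      Finset.sum_add_distrib]
  map_smul' c f := by
    simp [contractTensor, LinearMap.smul_comp, TensorProduct.map_smul_right, LinearMap.comp_smul,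
      ← Finset.smul_sum]

theorem contract_apply (f : Module.Dual ℂ g.Env) (x : g.Env) : g.contract f x =
    g.contractTensor f ((GradedTensorProduct.of ℂ g.envDeg g.envDeg).symm (g.comul x)) := rfl

theorem dualMul_apply (φ f : Module.Dual ℂ g.Env) (x : g.Env) :
    g.dualMul φ f x = φ (g.contract f x) := by
  refine LinearMap.congr_fun (f := g.pairTensor φ f) (g := φ ∘ₗ g.contractTensor f)
    (TensorProduct.ext' fun a b => ?_) _
  simp only [pairTensor, contractTensor, twist, LinearMap.sum_apply, LinearMap.smul_apply,
    LinearMap.comp_apply, TensorProduct.map_tmul, LinearMap.mul'_apply, LinearEquiv.coe_coe,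
    TensorProduct.rid_tmul, map_sum, map_smul, smul_eq_mul]
  rw [Finset.sum_comm]
  refine Finset.sum_congr rfl fun j _ => ?_
  rw [Finset.mul_sum]
  refine Finset.sum_congr rfl fun i _ => ?_
  ring

@[simp]
theorem contract_one (f : Module.Dual ℂ g.Env) : g.contract f 1 = f 1 • 1 := by
  rw [contract_apply, map_one, GradedTensorProduct.of_symm_one, Algebra.TensorProduct.one_def,
    g.contractTensor_tmul f 1 g.one_mem_envDeg, twist_one]

/-- Contraction turns left multiplication by `X` into a super Leibniz rule, because
`Δ(X y) = (X ⊗ 1 + 1 ⊗ X) Δ(y)`. -/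
theorem contract_ι_mul (f : Module.Dual ℂ g.Env) {p : ZMod 2} (X : g.deg p) (y : g.Env) :
    g.contract f (g.ι X.1 * y) = g.contract (f ∘ₗ LinearMap.mulLeft ℂ (g.ι X.1)) y +
      g.ι X.1 * g.contract (f ∘ₗ twist g.envDeg p) y := by
  have hX : g.comul (g.ι X.1) = (g.ι X.1) ᵍ⊗ₜ[ℂ] 1 + 1 ᵍ⊗ₜ[ℂ] (g.ι X.1) := by
    rw [comul, lift_ι]
    rfl
  rw [contract_apply, map_mul, hX]
  refine LinearMap.congr_fun (R := ℂ)
    (f := g.contractTensor f ∘ₗ (GradedTensorProduct.of ℂ g.envDeg g.envDeg).symm.toLinearMap ∘ₗ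
      LinearMap.mulLeft ℂ ((g.ι X.1) ᵍ⊗ₜ[ℂ] 1 + 1 ᵍ⊗ₜ[ℂ] (g.ι X.1) :
        g.envDeg ᵍ⊗[ℂ] g.envDeg) ∘ₗ (GradedTensorProduct.of ℂ g.envDeg g.envDeg).toLinearMap)
    (g := g.contractTensor (f ∘ₗ LinearMap.mulLeft ℂ (g.ι X.1)) +
      LinearMap.mulLeft ℂ (g.ι X.1) ∘ₗ g.contractTensor (f ∘ₗ twist g.envDeg p))
    (TensorProduct.ext (hom_ext (𝒱 := g.envDeg) fun i a ha =>
      hom_ext (𝒱 := g.envDeg) fun l b hb => ?_))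
    ((GradedTensorProduct.of ℂ g.envDeg g.envDeg).symm (g.comul y))
  have h1 := GradedTensorProduct.tmul_one_mul_coe_tmul (R := ℂ) g.envDeg g.envDeg (g.ι X.1)
    ⟨a, ha⟩ b
  have h2 := GradedTensorProduct.tmul_coe_mul_coe_tmul (R := ℂ) g.envDeg g.envDeg 1
    ⟨g.ι X.1, g.ι_mem_envDeg X.2⟩ ⟨a, ha⟩ b
  rw [units_smul_eq_sgn_smul, one_mul] at h2
  dsimp only at h1 h2
  change g.contractTensor f ((GradedTensorProduct.of ℂ g.envDeg g.envDeg).symm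
    (((g.ι X.1) ᵍ⊗ₜ[ℂ] 1 + 1 ᵍ⊗ₜ[ℂ] (g.ι X.1) : g.envDeg ᵍ⊗[ℂ] g.envDeg) * a ᵍ⊗ₜ[ℂ] b)) =
    g.contractTensor _ (a ⊗ₜ b) + g.ι X.1 * g.contractTensor _ (a ⊗ₜ b)
  rw [add_mul]
  rw [h1, h2, map_add, map_smul, GradedTensorProduct.of_symm_of,
    GradedTensorProduct.of_symm_of, map_add, map_smul, g.contractTensor_tmul _ _ hb,
    g.contractTensor_tmul _ _ hb, g.contractTensor_tmul _ _ (g.ι_mul_mem_envDeg X hb),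
    g.contractTensor_tmul _ _ hb]
  simp only [LinearMap.comp_apply, LinearMap.mulLeft_apply, twist_of_mem _ hb,
    twist_of_mem _ ha, twist_ι_mul, map_smul, smul_smul, mul_smul_comm, smul_eq_mul]
  rw [add_comm]
  congr 2
  · rw [add_mul, sgn_add, mul_left_comm, ← mul_assoc (sgn (p * i)), sgn_mul_self, one_mul]
  · rw [mul_comm l p]
    ring

@[simp]
theorem contract_counit : g.contract g.counit.toLinearMap = 1 := by
  refine g.linearMap_ext_word fun l => ?_
  induction l with
  | nil => simp
  | cons q l ih =>
    have h1 : g.counit.toLinearMap ∘ₗ LinearMap.mulLeft ℂ (g.ι q.2.1) = 0 :=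
      LinearMap.ext fun y => by simp
    have h2 : g.counit.toLinearMap ∘ₗ twist g.envDeg q.1 = g.counit.toLinearMap :=
      LinearMap.ext fun y => g.counit_twist _ y
    rw [word_cons, contract_ι_mul, h1, h2, ih, map_zero]
    simp

/-! ### The filtration of `U(g)` by the length of words -/

/-- The span of the words of length less than `N`. The strict inequality makes `filt 0` zero. -/
def filt (N : ℕ) : Submodule ℂ g.Env :=
  Submodule.span ℂ (g.word '' {l | l.length < N})

theorem word_mem_filt {l : List (Σ i : ZMod 2, g.deg i)} {N : ℕ} (h : l.length < N) :
    g.word l ∈ g.filt N :=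
  Submodule.subset_span ⟨l, h, rfl⟩

theorem filt_mono {M N : ℕ} (h : M ≤ N) : g.filt M ≤ g.filt N :=
  Submodule.span_mono (Set.image_mono fun _ hl => lt_of_lt_of_le hl h)

theorem exists_mem_filt (x : g.Env) : ∃ N, x ∈ g.filt N := by
  have hx : x ∈ Submodule.span ℂ (Set.range g.word) := by
    rw [g.span_range_word]
    trivial
  induction hx using Submodule.span_induction with
  | mem x hx =>
    obtain ⟨l, rfl⟩ := hx
    exact ⟨_, g.word_mem_filt (Nat.lt_succ_self _)⟩
  | zero => exact ⟨0, Submodule.zero_mem _⟩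
  | add x y _ _ hx hy =>
    obtain ⟨M, hM⟩ := hx
    obtain ⟨N, hN⟩ := hy
    exact ⟨max M N, Submodule.add_mem _ (g.filt_mono (le_max_left _ _) hM)
      (g.filt_mono (le_max_right _ _) hN)⟩
  | smul c x _ hx =>
    obtain ⟨N, hN⟩ := hx
    exact ⟨N, Submodule.smul_mem _ c hN⟩

theorem ι_mul_mem_filt {p : ZMod 2} (X : g.deg p) {N : ℕ} {y : g.Env} (hy : y ∈ g.filt N) :
    g.ι X.1 * y ∈ g.filt (N + 1) := by
  induction hy using Submodule.span_induction with
  | mem x hx =>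
    obtain ⟨l, hl, rfl⟩ := hx
    rw [← g.word_cons ⟨p, X⟩ l]
    exact g.word_mem_filt (Nat.succ_lt_succ hl)
  | zero => simp
  | add x y _ _ hx hy =>
    rw [mul_add]
    exact Submodule.add_mem _ hx hy
  | smul c x _ hx =>
    rw [mul_smul_comm]
    exact Submodule.smul_mem _ c hx

/-- A linear form is the sum of a multiple of the counit and of a form that vanishes at `1`; the
counit contracts to the identity. -/
theorem contract_eq_smul_add (f : Module.Dual ℂ g.Env) (y : g.Env) :
    g.contract f y = f 1 • y + g.contract (f - f 1 • g.counit.toLinearMap) y := by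
  simp

theorem sub_smul_counit_one (f : Module.Dual ℂ g.Env) :
    (f - f 1 • g.counit.toLinearMap) 1 = 0 := by
  simp

/-- Contraction with a linear form that vanishes at `1` lowers the filtration. -/
theorem contract_word_mem_filt (l : List (Σ i : ZMod 2, g.deg i)) :
    ∀ f : Module.Dual ℂ g.Env, f 1 = 0 → g.contract f (g.word l) ∈ g.filt l.length := by
  induction l with
  | nil =>
    intro f hf
    simp [hf]
  | cons q l ih =>
    intro f hf
    rw [word_cons, contract_ι_mul, contract_eq_smul_add, List.length_cons]
    refine Submodule.add_mem _ (Submodule.add_mem _ (Submodule.smul_mem _ _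
      (g.word_mem_filt (Nat.lt_succ_self _)))
      (g.filt_mono (Nat.le_succ _) (ih _ (g.sub_smul_counit_one _)))) ?_
    exact g.ι_mul_mem_filt q.2 (ih _ (by simpa using hf))

theorem contract_mem_filt {f : Module.Dual ℂ g.Env} (hf : f 1 = 0) {N : ℕ} {x : g.Env}
    (hx : x ∈ g.filt (N + 1)) : g.contract f x ∈ g.filt N := by
  induction hx using Submodule.span_induction with
  | mem x hx =>
    obtain ⟨l, hl, rfl⟩ := hx
    exact g.filt_mono (Nat.le_of_lt_succ hl) (g.contract_word_mem_filt l f hf)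
  | zero => simp
  | add x y _ _ hx hy =>
    rw [map_add]
    exact Submodule.add_mem _ hx hy
  | smul c x _ hx =>
    rw [map_smul]
    exact Submodule.smul_mem _ c hx

/-! ### The Euler operator -/

section Euler

variable {I : Type*} [Fintype I] (X : I → Σ i : ZMod 2, g.deg i) (f : I → Module.Dual ℂ g.Env)

/-- The operator `x ↦ ∑ᵢ Xᵢ · contract fᵢ x`. For a basis `Xᵢ` of `g` and forms `fᵢ` dual to it,
its leading part is the Euler operator of the supersymmetric algebra of `g`. -/
def euler : Module.End ℂ g.Env := ∑ i, LinearMap.mulLeft ℂ (g.ι (X i).2.1) ∘ₗ g.contract (f i)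

theorem euler_apply (x : g.Env) :
    g.euler X f x = ∑ i, g.ι (X i).2.1 * g.contract (f i) x := by
  simp [euler]

/-- On words of length `N`, the Euler operator is multiplication by `N` up to shorter words. -/
theorem euler_word_sub_mem_filt (hf : ∀ i, f i 1 = 0)
    (hp : ∀ i p, f i ∘ₗ twist g.envDeg p = sgn (p * (X i).1) • f i)
    (hdual : ∀ (p : ZMod 2) (Y : g.deg p), ∑ i, f i (g.ι Y.1) • (X i).2.1 = Y.1)
    (l : List (Σ i : ZMod 2, g.deg i)) :
    g.euler X f (g.word l) - (l.length : ℂ) • g.word l ∈ g.filt l.length := by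
  induction l with
  | nil => simp [euler_apply, hf]
  | cons q l ih =>
    -- the contraction of `q · word l`, with `q` moved to the left of every `Xᵢ`
    have hterm : ∀ i, g.ι (X i).2.1 * g.contract (f i) (g.word (q :: l)) =
        f i (g.ι q.2.1) • (g.ι (X i).2.1 * g.word l) +
        g.ι q.2.1 * (g.ι (X i).2.1 * g.contract (f i) (g.word l)) +
        (g.ι (X i).2.1 * g.contract (f i ∘ₗ LinearMap.mulLeft ℂ (g.ι q.2.1) -
          f i (g.ι q.2.1) • g.counit.toLinearMap) (g.word l) +
        sgn (q.1 * (X i).1) • (g.ι (g.bracket (X i).2 q.2) * g.contract (f i) (g.word l))) := by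
      intro i
      have hc := g.ι_mul_ι (X i).2 q.2
      rw [word_cons, contract_ι_mul, contract_eq_smul_add, hp i, map_smul, LinearMap.smul_apply,
        mul_smul_comm, mul_add, mul_add, mul_smul_comm, mul_smul_comm,
        ← mul_assoc (g.ι (X i).2.1) (g.ι q.2.1), hc, add_mul, smul_add, smul_mul_assoc,
        smul_smul, mul_comm (X i).1, sgn_mul_self, one_smul, mul_assoc]
      simp only [LinearMap.comp_apply, LinearMap.mulLeft_apply, mul_one]
      abel
    have hsum : ∑ i, f i (g.ι q.2.1) • (g.ι (X i).2.1 * g.word l) = g.ι q.2.1 * g.word l := by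
      conv_rhs => rw [← hdual q.1 q.2, map_sum, Finset.sum_mul]
      exact Finset.sum_congr rfl fun i _ => by rw [map_smul, smul_mul_assoc]
    have key : g.euler X f (g.word (q :: l)) -
        ((q :: l).length : ℂ) • g.word (q :: l) =
        g.ι q.2.1 * (g.euler X f (g.word l) - (l.length : ℂ) • g.word l) +
        ∑ i, (g.ι (X i).2.1 * g.contract (f i ∘ₗ LinearMap.mulLeft ℂ (g.ι q.2.1) -
          f i (g.ι q.2.1) • g.counit.toLinearMap) (g.word l) +
        sgn (q.1 * (X i).1) • (g.ι (g.bracket (X i).2 q.2) * g.contract (f i) (g.word l))) := by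
      rw [euler_apply, Finset.sum_congr rfl fun i _ => hterm i, Finset.sum_add_distrib,
        Finset.sum_add_distrib, hsum, ← Finset.mul_sum, ← euler_apply, mul_sub, mul_smul_comm,
        ← word_cons, List.length_cons, Nat.cast_succ, add_smul, one_smul]
      abel
    rw [key, List.length_cons]
    refine Submodule.add_mem _ (g.ι_mul_mem_filt q.2 ih) (Submodule.sum_mem _ fun i _ =>
      Submodule.add_mem _ (g.ι_mul_mem_filt (X i).2 (g.contract_word_mem_filt l _ (by simp)))
        (Submodule.smul_mem _ _ ?_))
    exact g.ι_mul_mem_filt ⟨g.bracket (X i).2 q.2, g.bracket_mem _ _⟩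
      (g.contract_word_mem_filt l _ (hf i))

theorem euler_sub_mem_filt (hf : ∀ i, f i 1 = 0)
    (hp : ∀ i p, f i ∘ₗ twist g.envDeg p = sgn (p * (X i).1) • f i)
    (hdual : ∀ (p : ZMod 2) (Y : g.deg p), ∑ i, f i (g.ι Y.1) • (X i).2.1 = Y.1)
    {N : ℕ} {x : g.Env} (hx : x ∈ g.filt (N + 1)) :
    g.euler X f x - (N : ℂ) • x ∈ g.filt N := by
  induction hx using Submodule.span_induction with
  | mem x hx =>
    obtain ⟨l, hl, rfl⟩ := hx
    have h := g.euler_word_sub_mem_filt X f hf hp hdual l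
    rcases (Nat.le_of_lt_succ hl).eq_or_lt with rfl | hlt
    · exact h
    · have hw := g.word_mem_filt hlt
      have h' := Submodule.add_mem _ (g.filt_mono hlt.le h)
        (Submodule.smul_mem _ ((l.length : ℂ) - N) hw)
      rw [sub_smul] at h'
      convert h' using 1
      abel
  | zero => simp
  | add x y _ _ hx hy =>
    rw [map_add, smul_add, add_sub_add_comm]
    exact Submodule.add_mem _ hx hy
  | smul c x _ hx =>
    rw [map_smul, smul_comm, ← smul_sub]
    exact Submodule.smul_mem _ c hx

/-- A subspace of `U(g)` that is annihilated by the counit and stable under contraction with forms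
dual to a basis of `g` is zero: an element of least filtration degree `N` in it is killed by the
contractions, which lower the degree, hence by the Euler operator, which multiplies it by `N` up
to lower degree; for `N = 0` the counit detects it. -/
theorem eq_bot_of_contract_mem (hf : ∀ i, f i 1 = 0)
    (hp : ∀ i p, f i ∘ₗ twist g.envDeg p = sgn (p * (X i).1) • f i)
    (hdual : ∀ (p : ZMod 2) (Y : g.deg p), ∑ i, f i (g.ι Y.1) • (X i).2.1 = Y.1)
    (K : Submodule ℂ g.Env) (hε : ∀ x ∈ K, g.counit x = 0)
    (hK : ∀ i, ∀ x ∈ K, g.contract (f i) x ∈ K) : K = ⊥ := by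
  have main : ∀ N, ∀ x ∈ K, x ∈ g.filt N → x = 0 := by
    intro N
    induction N with
    | zero =>
      intro x _ hx
      simpa [filt] using hx
    | succ N ih =>
      intro x hxK hx
      have hE : g.euler X f x = 0 := by
        rw [euler_apply]
        refine Finset.sum_eq_zero fun i _ => ?_
        rw [ih _ (hK i x hxK) (g.contract_mem_filt (hf i) hx), mul_zero]
      rcases Nat.eq_zero_or_pos N with rfl | hN
      · -- the Euler operator says nothing about multiples of `1`, which the counit detects
        have h1 : g.word '' {l | l.length < 0 + 1} = {1} := by
          ext y
          constructor
          · rintro ⟨l, hl, rfl⟩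
            rw [List.length_eq_zero_iff.mp (Nat.lt_one_iff.mp hl)]
            rfl
          · rintro rfl
            exact ⟨[], Nat.zero_lt_one, rfl⟩
        rw [filt, h1, Submodule.mem_span_singleton] at hx
        obtain ⟨c, rfl⟩ := hx
        have hc := hε _ hxK
        rw [map_smul, map_one, smul_eq_mul, mul_one] at hc
        rw [hc, zero_smul]
      · have h := g.euler_sub_mem_filt X f hf hp hdual hx
        rw [hE, zero_sub, ← neg_smul] at h
        exact ih x hxK ((Submodule.smul_mem_iff _
          (neg_ne_zero.mpr (Nat.cast_ne_zero.mpr hN.ne'))).mp h)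
  refine (Submodule.eq_bot_iff _).mpr fun x hx => ?_
  obtain ⟨N, hN⟩ := g.exists_mem_filt x
  exact main N x hx hN

end Euler

/-! ### Matrix elements of the defining representation -/

@[simp]
theorem stdRep_ι (X : g.toSubmodule) : g.stdRep (g.ι X) = X.1 := by
  simp [stdRep]

theorem stdRep_mem_homDeg {k : ZMod 2} {x : g.Env} (hx : x ∈ g.envDeg k) :
    g.stdRep x ∈ homDeg 𝒱 k := by
  induction hx using Submodule.span_induction with
  | mem x hx =>
    obtain ⟨l, rfl, rfl⟩ := hx
    induction l with
    | nil =>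
      intro j v hv
      simpa using hv
    | cons q l ih =>
      intro j v hv
      have h := q.2.2 _ _ (ih j v hv)
      rw [add_assoc, add_comm _ q.1] at h
      simpa using h
  | zero => simp
  | add x y _ _ hx hy =>
    rw [map_add]
    exact Submodule.add_mem _ hx hy
  | smul c x _ hx =>
    rw [map_smul]
    exact Submodule.smul_mem _ c hx

theorem homComp_stdRep (k : ZMod 2) (x : g.Env) :
    homComp 𝒱 k (g.stdRep x) = g.stdRep (proj g.envDeg k x) := by
  refine LinearMap.congr_fun (f := homComp 𝒱 k ∘ₗ g.stdRep.toLinearMap)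
    (g := g.stdRep.toLinearMap ∘ₗ proj g.envDeg k) (hom_ext (𝒱 := g.envDeg) fun j a ha => ?_) x
  simp only [LinearMap.comp_apply, AlgHom.toLinearMap_apply]
  by_cases h : j = k
  · subst h
    rw [homComp_of_mem (g.stdRep_mem_homDeg ha), proj_of_mem ha]
  · rw [homComp_of_mem_ne (g.stdRep_mem_homDeg ha) h, proj_of_mem_ne ha h, map_zero]

/-- A subspace of `U(g)` is zero if the counit annihilates it and if it is stable under contraction
with all matrix elements of the defining representation. The forms dual to a basis of `g` are
obtained from matrix elements by subtracting their value at `1`. -/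
theorem eq_bot_of_contract_stdRep_mem [FiniteDimensional ℂ V] (K : Submodule ℂ g.Env)
    (hε : ∀ x ∈ K, g.counit x = 0)
    (hK : ∀ φ : Module.Dual ℂ (Module.End ℂ V), ∀ x ∈ K,
      g.contract (φ ∘ₗ g.stdRep.toLinearMap) x ∈ K) : K = ⊥ := by
  let b := Module.finBasis ℂ g.toSubmodule
  choose φ hφ using fun i => LinearMap.exists_extend (b.coord i)
  have hφ' : ∀ i (Y : g.toSubmodule), φ i Y.1 = b.repr Y i := fun i Y =>
    LinearMap.congr_fun (hφ i) Y
  -- The basis need not be homogeneous: the family of the components of its elements is used.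
  obtain ⟨h, hdef⟩ : ∃ h : Fin (Module.finrank ℂ g.toSubmodule) × ZMod 2 → Module.Dual ℂ g.Env,
      ∀ i, h i = (φ i.1 ∘ₗ homComp 𝒱 i.2) ∘ₗ g.stdRep.toLinearMap := ⟨_, fun _ => rfl⟩
  have hh : ∀ i x, h i x = φ i.1 (g.stdRep (proj g.envDeg i.2 x)) := fun i x => by
    rw [hdef, ← homComp_stdRep]
    rfl
  have hp : ∀ i p x, h i (twist g.envDeg p x) = sgn (p * i.2) * h i x := fun i p x => by
    rw [hh, hh, proj_twist, map_smul, map_smul, smul_eq_mul]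
  let X : Fin (Module.finrank ℂ g.toSubmodule) × ZMod 2 → Σ i : ZMod 2, g.deg i := fun i =>
    ⟨i.2, g.comp i.2 (b i.1), g.comp_mem i.2 (b i.1)⟩
  obtain ⟨f, hf⟩ : ∃ f : Fin (Module.finrank ℂ g.toSubmodule) × ZMod 2 → Module.Dual ℂ g.Env,
      ∀ i, f i = h i - h i 1 • g.counit.toLinearMap := ⟨_, fun _ => rfl⟩
  refine g.eq_bot_of_contract_mem X f ?_ ?_ ?_ K hε ?_
  · intro i
    rw [hf, sub_smul_counit_one]
  · intro i p
    refine LinearMap.ext fun x => ?_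
    have h1 := hp i p 1
    rw [twist_one] at h1
    simp only [hf, LinearMap.comp_apply, LinearMap.sub_apply, LinearMap.smul_apply,
      AlgHom.toLinearMap_apply, counit_twist, hp, smul_eq_mul, X]
    rw [mul_sub, ← mul_assoc, ← h1]
  · intro p Y
    have hY : ∀ i, f i (g.ι Y.1) =
        b.repr (g.comp i.2 Y.1) i.1 := fun i => by
      have h0 : h i (g.ι Y.1) = φ i.1 (homComp 𝒱 i.2 Y.1.1) := by
        rw [hdef, ← stdRep_ι]
        rfl
      rw [← hφ', hf, LinearMap.sub_apply, LinearMap.smul_apply, AlgHom.toLinearMap_apply, counit_ι,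
        smul_zero, sub_zero, h0]
      rfl
    have hc : ∀ k, g.comp k (g.comp k Y.1) = g.comp k Y.1 := fun k =>
      g.comp_of_mem (g.comp_mem k _)
    simp only [hY, X]
    rw [Fintype.sum_prod_type_right]
    refine (Finset.sum_congr rfl fun k _ => ?_).trans (g.sum_comp Y.1)
    simp only [← map_smul]
    rw [← map_sum, b.sum_repr, hc]
  · intro i x hx
    rw [hf, map_sub, map_smul, contract_counit, hdef]
    exact Submodule.sub_mem _ (hK _ x hx) (Submodule.smul_mem _ _ hx)

/-! ### Tensor powers -/

section Tensor

/-- The contraction of the last factor of a tensor power with a linear form. -/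
def contractLast (r : ℕ) (ψ : Module.Dual ℂ V) :
    (⨂[ℂ] (_ : Fin (r + 1)), V) →ₗ[ℂ] ⨂[ℂ] (_ : Fin r), V :=
  PiTensorProduct.lift (MultilinearMap.uncurryRight
    ((LinearMap.smulRightₗ (R := ℂ) ψ).compMultilinearMap (PiTensorProduct.tprod ℂ)))

theorem contractLast_tprod (r : ℕ) (ψ : Module.Dual ℂ V) (v : Fin (r + 1) → V) :
    contractLast r ψ (PiTensorProduct.tprod ℂ v) =
      ψ (v (Fin.last r)) • PiTensorProduct.tprod ℂ (Fin.init v) := by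
  simp [contractLast]

/-- The insertion of a vector as the last factor of a tensor power. -/
def insertLast (r : ℕ) (w : V) :
    (⨂[ℂ] (_ : Fin r), V) →ₗ[ℂ] ⨂[ℂ] (_ : Fin (r + 1)), V :=
  PiTensorProduct.lift ((LinearMap.applyₗ w).compMultilinearMap
    (MultilinearMap.curryRight (M := fun _ => V)
      (PiTensorProduct.tprod ℂ : MultilinearMap ℂ (fun _ : Fin (r + 1) => V) _)))

theorem insertLast_tprod (r : ℕ) (w : V) (v : Fin r → V) :
    insertLast r w (PiTensorProduct.tprod ℂ v) =
      PiTensorProduct.tprod ℂ (Fin.snoc (α := fun _ => V) v w) := by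
  simp [insertLast]

theorem contractLast_insertLast (r : ℕ) (ψ : Module.Dual ℂ V) (w : V) :
    contractLast r ψ ∘ₗ insertLast r w = ψ w • LinearMap.id := by
  refine PiTensorProduct.ext (MultilinearMap.ext fun v => ?_)
  simp [insertLast_tprod, contractLast_tprod]

variable (𝒱) in
/-- The map `v ↦ (-1)^{i [v]} v` on a tensor power. -/
def tensorTwist (r : ℕ) (i : ZMod 2) : Module.End ℂ (⨂[ℂ] (_ : Fin r), V) :=
  PiTensorProduct.map fun _ => twist 𝒱 i

theorem tensorTwist_zero (r : ℕ) : tensorTwist 𝒱 r 0 = 1 := by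
  rw [tensorTwist, twist_zero]
  exact PiTensorProduct.map_one

theorem tensorTwist_mul (r : ℕ) (i j : ZMod 2) :
    tensorTwist 𝒱 r i * tensorTwist 𝒱 r j = tensorTwist 𝒱 r (i + j) := by
  rw [tensorTwist, tensorTwist, tensorTwist, ← PiTensorProduct.map_mul]
  simp only [twist_mul_twist]

theorem tensorTwist_mul_tensorSlot (r : ℕ) {i j : ZMod 2} (k : Fin r) {X : Module.End ℂ V}
    (hX : X ∈ homDeg 𝒱 i) : tensorTwist 𝒱 r j * tensorSlot 𝒱 r i k X =
      sgn (i * j) • (tensorSlot 𝒱 r i k X * tensorTwist 𝒱 r j) := by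
  have hk : ∀ m : Fin r, (twist 𝒱 j *
      (if m < k then twist 𝒱 i else if m = k then X else LinearMap.id) : Module.End ℂ V) =
      Function.update (fun m => (if m < k then twist 𝒱 i else if m = k then X else LinearMap.id) *
        twist 𝒱 j) k (sgn (i * j) • (X * twist 𝒱 j)) m := by
    intro m
    rcases lt_trichotomy m k with hm | rfl | hm
    · rw [Function.update_of_ne hm.ne]
      simp [hm, twist_mul_twist, add_comm]
    · simp [twist_mul hX]
    · rw [Function.update_of_ne hm.ne']
      simp only [hm.not_gt, hm.ne', if_false]
      exact (mul_one _).trans (one_mul _).symm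
  rw [tensorTwist, tensorSlot, ← PiTensorProduct.map_mul, ← PiTensorProduct.map_mul, funext hk,
    PiTensorProduct.map_update_smul]
  congr 2
  refine Function.update_eq_self_iff.mpr ?_
  simp

theorem tensorTwist_mul_tensorAct (r : ℕ) {i j : ZMod 2} {X : Module.End ℂ V}
    (hX : X ∈ homDeg 𝒱 i) : tensorTwist 𝒱 r j * tensorAct 𝒱 r X =
      sgn (i * j) • (tensorAct 𝒱 r X * tensorTwist 𝒱 r j) := by
  rw [tensorAct_of_mem r hX, Finset.mul_sum, Finset.sum_mul, Finset.smul_sum]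
  exact Finset.sum_congr rfl fun k _ => tensorTwist_mul_tensorSlot r k hX

/-- The action of `X` on a tensor power with `r + 1` factors, seen through the last factor. -/
theorem contractLast_tensorAct (r : ℕ) {p : ZMod 2} {X : Module.End ℂ V} (hX : X ∈ homDeg 𝒱 p)
    (ψ : Module.Dual ℂ V) : contractLast r ψ ∘ₗ tensorAct 𝒱 (r + 1) X =
      tensorAct 𝒱 r X ∘ₗ contractLast r ψ + tensorTwist 𝒱 r p ∘ₗ contractLast r (ψ ∘ₗ X) := by
  refine PiTensorProduct.ext (MultilinearMap.ext fun v => ?_)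
  simp only [LinearMap.compMultilinearMap_apply, LinearMap.comp_apply, LinearMap.add_apply,
    tensorAct_of_mem _ hX, LinearMap.sum_apply, map_sum, contractLast_tprod, map_smul,
    tensorTwist, PiTensorProduct.map_tprod]
  rw [Fin.sum_univ_castSucc, Finset.smul_sum]
  congr 1
  · refine Finset.sum_congr rfl fun k _ => ?_
    rw [tensorSlot, tensorSlot, PiTensorProduct.map_tprod, PiTensorProduct.map_tprod,
      contractLast_tprod]
    have h1 : ¬ Fin.last r < k.castSucc := (Fin.le_last _).not_gt
    have h2 : Fin.last r ≠ k.castSucc := (Fin.castSucc_lt_last k).ne'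
    rw [if_neg h1, if_neg h2]
    congr 2
    funext l
    simp [Fin.init]
  · rw [tensorSlot, PiTensorProduct.map_tprod, contractLast_tprod]
    simp only [lt_irrefl, if_false, if_true]
    congr 2
    funext l
    simp [Fin.init, Fin.castSucc_lt_last]

theorem tensorRep_ι (r : ℕ) (X : g.toSubmodule) : g.tensorRep r (g.ι X) = tensorAct 𝒱 r X.1 := by
  simp [tensorRep]

/-- The matrix element `x ↦ ψ(x w)` of the defining representation. -/
def matrixElem (ψ : Module.Dual ℂ V) (w : V) : Module.Dual ℂ g.Env :=
  ψ ∘ₗ LinearMap.applyₗ w ∘ₗ g.stdRep.toLinearMap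

theorem matrixElem_apply (ψ : Module.Dual ℂ V) (w : V) (x : g.Env) :
    g.matrixElem ψ w x = ψ (g.stdRep x w) := rfl

/-- The contraction of `x` with a homogeneous matrix element acts on a tensor power as a block of
the action of `x` on the next tensor power. -/
theorem tensorRep_contract (r : ℕ) {s : ZMod 2} {w : V} (hw : w ∈ 𝒱 s)
    (l : List (Σ i : ZMod 2, g.deg i)) : ∀ {q : ZMod 2} {ψ : Module.Dual ℂ V},
      (∀ k, ∀ v ∈ 𝒱 k, k ≠ q → ψ v = 0) →
      g.tensorRep r (g.contract (g.matrixElem ψ w) (g.word l)) =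
        tensorTwist 𝒱 r (q + s) ∘ₗ contractLast r ψ ∘ₗ g.tensorRep (r + 1) (g.word l) ∘ₗ
          insertLast r w := by
  induction l with
  | nil =>
    intro q ψ hψ
    rw [word_nil, contract_one, matrixElem_apply, map_smul, map_one, map_one, map_one]
    change _ = tensorTwist 𝒱 r (q + s) ∘ₗ (contractLast r ψ ∘ₗ insertLast r w)
    rw [contractLast_insertLast, Module.End.one_apply]
    by_cases h : s = q
    · have h2 : q + q = 0 := CharTwo.add_self_eq_zero q
      rw [h, h2, tensorTwist_zero]
      rfl
    · rw [hψ s w hw h, zero_smul, zero_smul, LinearMap.comp_zero]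
  | cons t l ih =>
    intro q ψ hψ
    have h1 : g.matrixElem ψ w ∘ₗ LinearMap.mulLeft ℂ (g.ι t.2.1) =
        g.matrixElem (ψ ∘ₗ t.2.1.1) w := by
      refine LinearMap.ext fun y => ?_
      simp [matrixElem_apply]
    have h2 : g.matrixElem ψ w ∘ₗ twist g.envDeg t.1 =
        sgn (t.1 * (q + s)) • g.matrixElem ψ w := by
      refine hom_ext (𝒱 := g.envDeg) fun j y hy => ?_
      have hv := g.stdRep_mem_homDeg hy s w hw
      rw [LinearMap.comp_apply, twist_of_mem _ hy, map_smul, LinearMap.smul_apply,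
        matrixElem_apply]
      by_cases h : s + j = q
      · have hss : s + s = 0 := CharTwo.add_self_eq_zero s
        rw [← h, add_right_comm, hss, zero_add]
      · rw [hψ _ _ hv h, smul_zero, smul_zero]
    have hψ' : ∀ k, ∀ v ∈ 𝒱 k, k ≠ q + t.1 → (ψ ∘ₗ t.2.1.1) v = 0 := by
      intro k v hv hk
      refine hψ _ _ (t.2.2 k v hv) fun h => hk ?_
      rw [← h, add_assoc, CharTwo.add_self_eq_zero, add_zero]
    have hX : t.2.1.1 ∈ homDeg 𝒱 t.1 := t.2.2
    have h3 := tensorTwist_mul_tensorAct (j := q + s) r hX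
    have h4 := contractLast_tensorAct r hX ψ
    rw [word_cons, contract_ι_mul, h1, h2, map_smul, LinearMap.smul_apply, mul_smul_comm, map_add,
      map_smul, map_mul, map_mul, ih hψ, ih hψ', tensorRep_ι, tensorRep_ι]
    have h5 : tensorTwist 𝒱 r (q + t.1 + s) =
        tensorTwist 𝒱 r (q + s) ∘ₗ tensorTwist 𝒱 r t.1 := by
      rw [add_right_comm]
      exact (tensorTwist_mul r _ _).symm
    refine LinearMap.ext fun v => ?_
    have h3' := fun u => LinearMap.congr_fun h3 u
    have h4' := fun u => LinearMap.congr_fun h4 u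
    simp only [Module.End.mul_apply, LinearMap.comp_apply, LinearMap.add_apply,
      LinearMap.smul_apply] at h3' h4'
    simp only [h5, Module.End.mul_apply, LinearMap.comp_apply, LinearMap.add_apply,
      LinearMap.smul_apply, h4', map_add, h3']
    exact add_comm _ _

theorem tensorRep_zero (x : g.Env) : g.tensorRep 0 x = g.counit x • 1 := by
  have h : g.tensorRep 0 = (Algebra.ofId ℂ _).comp g.counit := by
    refine g.algHom_ext fun X => ?_
    rw [tensorRep_ι, AlgHom.comp_apply, counit_ι, map_zero]
    exact LinearMap.ext fun v => by simp [tensorAct]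
  rw [h, AlgHom.comp_apply, Algebra.ofId_apply, Algebra.algebraMap_eq_smul_one]

end Tensor

end LinearLieSuperalgebra

open LinearLieSuperalgebra

/-- The expansion of a linear form on `End(V)` with respect to matrix units. -/
theorem dual_end_eq_sum {V κ : Type*} [AddCommGroup V] [Module ℂ V] [Fintype κ] [DecidableEq κ]
    (b : Module.Basis κ ℂ V) (φ : Module.Dual ℂ (Module.End ℂ V)) (X : Module.End ℂ V) :
    φ X = ∑ j, ∑ i, φ ((b.coord j).smulRight (b i)) * b.coord i (X (b j)) := by
  have hX : X = ∑ j, ∑ i, b.coord i (X (b j)) • (b.coord j).smulRight (b i) := by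
    refine b.ext fun a => ?_
    simp only [LinearMap.sum_apply, LinearMap.smul_apply, LinearMap.smulRight_apply,
      Module.Basis.coord_apply, Module.Basis.repr_self, Finsupp.single_apply]
    simp [b.sum_repr]
  conv_lhs => rw [hX]
  simp [mul_comm]

/-- Graded version of Harish-Chandra's theorem. -/
theorem exists_tensorRep_ne_zero {V : Type*} [AddCommGroup V] [Module ℂ V]
    [FiniteDimensional ℂ V] {𝒱 : ZMod 2 → Submodule ℂ V} [DirectSum.Decomposition 𝒱]
    (g : LinearLieSuperalgebra 𝒱) {x : g.Env} (hx : x ≠ 0) : ∃ r : ℕ, g.tensorRep r x ≠ 0 := by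
  by_contra! hcon
  let K : Submodule ℂ g.Env := ⨅ r, LinearMap.ker (g.tensorRep r).toLinearMap
  have hmem : ∀ y, y ∈ K ↔ ∀ r, g.tensorRep r y = 0 := fun y => by
    simp [K]
  have hbot : K = ⊥ := by
    refine g.eq_bot_of_contract_stdRep_mem K (fun y hy => ?_) fun φ y hy => ?_
    · have h := LinearMap.congr_fun ((hmem y).mp hy 0) (PiTensorProduct.tprod ℂ Fin.elim0)
      have h' := congrArg (PiTensorProduct.isEmptyEquiv (R := ℂ) (s := fun _ => V) (Fin 0)) h
      rw [tensorRep_zero] at h'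
      simpa using h'
    · -- stability under contraction with homogeneous matrix elements
      have hhom : ∀ (q s : ZMod 2) (ψ : Module.Dual ℂ V) (w : V),
          g.contract (g.matrixElem (ψ ∘ₗ proj 𝒱 q) (proj 𝒱 s w)) y ∈ K := by
        intro q s ψ w
        refine (hmem _).mpr fun r => ?_
        have hψ : ∀ k, ∀ v ∈ 𝒱 k, k ≠ q → (ψ ∘ₗ proj 𝒱 q) v = 0 := by
          intro k v hv hk
          rw [LinearMap.comp_apply, proj_of_mem_ne hv hk, map_zero]
        have h : g.tensorRep r (g.contract (g.matrixElem (ψ ∘ₗ proj 𝒱 q) (proj 𝒱 s w)) y) =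
            tensorTwist 𝒱 r (q + s) ∘ₗ contractLast r (ψ ∘ₗ proj 𝒱 q) ∘ₗ
              g.tensorRep (r + 1) y ∘ₗ insertLast r (proj 𝒱 s w) := by
          refine LinearMap.congr_fun
            (f := (g.tensorRep r).toLinearMap ∘ₗ
              g.contract (g.matrixElem (ψ ∘ₗ proj 𝒱 q) (proj 𝒱 s w)))
            (g := LinearMap.llcomp ℂ _ _ _ (tensorTwist 𝒱 r (q + s) ∘ₗ
                contractLast r (ψ ∘ₗ proj 𝒱 q)) ∘ₗ
              LinearMap.lcomp ℂ _ (insertLast r (proj 𝒱 s w)) ∘ₗ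
              (g.tensorRep (r + 1)).toLinearMap)
            (g.linearMap_ext_word fun l => ?_) y
          exact g.tensorRep_contract r (proj_mem s w) l hψ
        rw [h, (hmem y).mp hy (r + 1), LinearMap.zero_comp, LinearMap.comp_zero,
          LinearMap.comp_zero]
      have hall : ∀ (ψ : Module.Dual ℂ V) (w : V), g.contract (g.matrixElem ψ w) y ∈ K := by
        intro ψ w
        have hsum : g.matrixElem ψ w =
            ∑ q, ∑ s, g.matrixElem (ψ ∘ₗ proj 𝒱 q) (proj 𝒱 s w) := by
          refine LinearMap.ext fun z => ?_
          simp only [LinearMap.sum_apply, matrixElem_apply, LinearMap.comp_apply]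
          simp only [← map_sum]
          rw [sum_proj, sum_proj]
        rw [hsum]
        simp only [map_sum, LinearMap.sum_apply]
        exact Submodule.sum_mem _ fun q _ => Submodule.sum_mem _ fun s _ => hhom q s ψ w
      let b := Module.finBasis ℂ V
      have hφ : φ ∘ₗ g.stdRep.toLinearMap = ∑ j, ∑ i,
          φ ((b.coord j).smulRight (b i)) • g.matrixElem (b.coord i) (b j) := by
        refine LinearMap.ext fun z => ?_
        rw [LinearMap.comp_apply, dual_end_eq_sum b]
        simp [matrixElem_apply]
      rw [hφ]
      simp only [map_sum, map_smul, LinearMap.sum_apply, LinearMap.smul_apply]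
      exact Submodule.sum_mem _ fun j _ => Submodule.sum_mem _ fun i _ =>
        Submodule.smul_mem _ _ (hall _ _)
  refine hx ?_
  have hxK : x ∈ K := (hmem x).mpr hcon
  rwa [hbot, Submodule.mem_bot] at hxK

/-- The matrix elements of the defining representation of `sl(m|n)` suffice for density. -/
theorem functionAlgebra_isDenseInDual (m n : ℕ) :
    (slmn m n).IsDenseInDual (functionAlgebra m n) := by
  intro x hx
  by_contra! hcon
  let K : Submodule ℂ (slmn m n).Env := (functionAlgebra m n).dualCoannihilator
  have hmem : ∀ y, y ∈ K ↔ ∀ a ∈ functionAlgebra m n, a y = 0 := fun y =>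
    Submodule.mem_dualCoannihilator y
  have hcounit : (slmn m n).counit.toLinearMap ∈ functionAlgebra m n :=
    Submodule.mem_sInf.mpr fun A hA => hA.1
  have ht : ∀ a b, tElem m n a b ∈ functionAlgebra m n := fun a b =>
    Submodule.mem_sInf.mpr fun A hA => hA.2.1 (Or.inl ⟨(a, b), rfl⟩)
  have hmul : ∀ φ ∈ functionAlgebra m n, ∀ ψ ∈ functionAlgebra m n,
      (slmn m n).dualMul φ ψ ∈ functionAlgebra m n := fun φ hφ ψ hψ =>
    Submodule.mem_sInf.mpr fun A hA =>
      hA.2.2 φ (Submodule.mem_sInf.mp hφ A hA) ψ (Submodule.mem_sInf.mp hψ A hA)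
  have hbot : K = ⊥ := by
    refine (slmn m n).eq_bot_of_contract_stdRep_mem K (fun y hy => (hmem y).mp hy _ hcounit)
      fun φ y hy => (hmem _).mpr fun a ha => ?_
    rw [← dualMul_apply]
    refine (hmem y).mp hy _ (hmul a ha _ ?_)
    let b := Pi.basisFun ℂ (Fin m ⊕ Fin n)
    have hφ : φ ∘ₗ (slmn m n).stdRep.toLinearMap = ∑ j, ∑ i,
        φ ((b.coord j).smulRight (b i)) • tElem m n i j := by
      refine LinearMap.ext fun z => ?_
      rw [LinearMap.comp_apply, dual_end_eq_sum b]
      simp [tElem, b]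
    rw [hφ]
    exact Submodule.sum_mem _ fun j _ => Submodule.sum_mem _ fun i _ =>
      Submodule.smul_mem _ _ (ht i j)
  refine hx ?_
  have hxK : x ∈ K := (hmem x).mpr hcon
  rwa [hbot, Submodule.mem_bot] at hxK

end SuperLie

end

theorem proposition3 :
    (∀ m n : ℕ, (SuperLie.slmn m n).IsDenseInDual (SuperLie.functionAlgebra m n)) ∧
      (∀ (V : Type*) [AddCommGroup V] [Module ℂ V] [FiniteDimensional ℂ V]
        (𝒱 : ZMod 2 → Submodule ℂ V) [DirectSum.Decomposition 𝒱]
        (g : SuperLie.LinearLieSuperalgebra 𝒱),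
        g.toSubmodule ≤ (SuperLie.sl 𝒱).toSubmodule →
        ∀ x : g.Env, x ≠ 0 → ∃ r : ℕ, g.tensorRep r x ≠ 0) :=
  ⟨SuperLie.functionAlgebra_isDenseInDual, fun _ _ _ _ _ _ g _ _ hx =>
    SuperLie.exists_tensorRep_ne_zero g hx⟩
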